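/- **Definitions.** Let $K,L,F,Z,S$ be positive integers with $L\le K$. A $(K,L,F,Z,S)$ *EPDA* (extended placement delivery array) is an $F\times K$ array with entries in $\{\star\}\cup[S]$ such that: $\star$ occurs exactly $Z$ times in each column; every $s\in[S]$ occurs; no integer occurs twice in a column; and for every $s\in[S]$, in the sub-array of the rows and columns that contain $s$, each row has at most $L$ integer entries. A $(K,F,Z,r)$ *caching array* is an $F\times K$ array $\mathbf C$ of $\star$'s and nulls with $Z$ stars in each column, in which any two distinct columns at cyclic distance less than $r$ have no star in a common row. For such $\mathbf C$, a $(\mathbf C,S,L)$ *delivery array* is an $F\times K$ array $\mathbf D$ with entries in $\{\star\}\cup[S]$ such that: $d_{j,k}=\star$ if and only if one of the columns $k,k+1,\dots,k+r-1$ (cyclically) of $\mathbf C$ has a $\star$ in row $j$; every $s\in[S]$ occurs and no integer occurs twice in a column; and for every $s$, in the sub-array of the rows and columns that contain $s$, each row has at most $L$ integer entries. **Network.** In the cyclic wrap-around multi-access coded caching (MACC) network there are $K$ users, $K$ caches of size $M$ files, a library of $N$ independent uniformly distributed files of $B$ bits, and a server with $L$ antennas; user $k$ accesses the $r$ caches $k,k+1,\dots,k+r-1$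 (cyclically). Put $t=KM/N$. In a scheme with subpacketization level $F$, each file is divided into $F$ subfiles of equal size (so $F\mid B$), each cache stores at most $MF$ subfiles, chosen before the demands and the channels are known, and for any demand vector $\mathbf d\in[N]^K$ the server sends a number of transmissions. In each channel use of a transmission it sends $\mathbf x\in\mathbb C^L$ with $\mathbb E\|\mathbf x\|^2\le P$, and user $k$ receives $\mathbf h_k^{\mathrm T}\mathbf x+n_k$, where the $n_k$ are independent $\mathcal{CN}(0,1)$ noises and the channel vectors $\mathbf h_k\in\mathbb C^L$ are constant during each transmission and known to the server and to all users. User $k$ estimates the file $d_k$ from the received signals and the accessible cache contents. The scheme is achievable for a channel realization if, for all sufficiently large $P$, the probability of error, in the worst case over demand vectors and users, tends to $0$ as $B\to\infty$. With $T(\mathbf d)$ the number of channel uses, its normalized delivery time is $$T_n=\lim_{P\to\infty}\lim_{B\to\infty}\frac{\max_{\mathbf d}T(\mathbf d)}{B/\log_2 P}.$$ A channel vector family $(\mathbf h_k)_{k}$ is *generic* if any $L$ of the vectors are linearly independent (this holds almost surely if the gains are drawn from a continuous distribution). **Statement.** Let $r\ge1$ and let $\mathbf A=[\mathbf a_1,\dots,\mathbf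 a_{K'}]$ be any $(K',L',F',Z',S')$ EPDA. Put $K=rK'$ and $L=rL'$. (a) Let $\mathbf C'$ be the $F'\times K$ array whose column $kr$ has its stars in the positions of the stars of $\mathbf a_k$, for each $k\in[K']$, and whose other entries are null. The array $\mathbf C$ obtained by stacking $\mathbf C'$ and its cyclic shifts of the columns to the right by $1,\dots,r-1$ places is a $(K,rF',Z',r)$ caching array. (b) Let $\mathbf D'$ be the $F'\times K$ array obtained from $\mathbf A$ by repeating each column $r$ times. The array $\mathbf D$ obtained by stacking, for $i=0,1,\dots,r-1$, the cyclic shift of the columns of $\mathbf D'$ to the right by $i$ places with $iS'$ added to each integer is a $(\mathbf C,rS',L)$ delivery array. (c) For every number $N\ge1$ of files and the cache size $M$ given by $t=KM/N=\frac{K'Z'}{F'}$, there is a multi-antenna coded caching scheme for the cyclic wrap-around MACC network with $K$ users and caches, each user accessing $r$ caches, and $L$ antennas, with subpacketization level $rF'$, in which cache $i$ stores the $j$-th subfile of every file if and only if $c_{j,i}=\star$, and which has $rS'$ transmissions, such that for every choice of a generic channel realization for each transmission the scheme is achievable and its normalized delivery time is $T_n=S'/F'$. -/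

import Mathlib

open MeasureTheory ProbabilityTheory Filter Topology

/-! ## Arrays

Rows, columns and integers are indexed from `0`: the row `j`, the column `k` and the integer `s`
of the usual notation are `j - 1`, `k - 1` and `s - 1` here. -/

/-- `A` is a `(K, L, F, Z, S)` extended placement delivery array; `none` is the symbol `⋆` and
`some s` is an integer. -/
structure IsEPDA (K L F Z S : ℕ) (A : Fin F → Fin K → Option (Fin S)) : Prop where
  K_pos : 0 < K
  L_pos : 0 < L
  L_le : L ≤ K
  F_pos : 0 < F
  Z_pos : 0 < Z
  S_pos : 0 < S
  /-- `⋆` appears `Z` times in each column. -/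
  card_star : ∀ k, (Finset.univ.filter fun j => A j k = none).card = Z
  /-- Every integer occurs. -/
  occurs : ∀ s, ∃ j k, A j k = some s
  /-- No integer appears more than once in a column. -/
  column : ∀ k s j₁ j₂, A j₁ k = some s → A j₂ k = some s → j₁ = j₂
  /-- In the sub-array of the rows and columns that contain `s`, each row has at most `L`
  integers. -/
  row : ∀ s j, (∃ k, A j k = some s) →
    (Finset.univ.filter fun k => (∃ i, A i k = some s) ∧ A j k ≠ none).card ≤ L

/-- The column (cache, user) that lies `i` places to the right of `k`, cyclically. -/
def cyclicAdd {K : ℕ} (k : Fin K) (i : ℕ) : Fin K :=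
  ⟨(k.val + i) % K, Nat.mod_lt _ (Nat.lt_of_le_of_lt (Nat.zero_le _) k.isLt)⟩

/-- `C` is a `(K, F, Z, r)` caching array; `true` is the symbol `⋆` and `false` is a null. -/
structure IsCachingArray (K F Z r : ℕ) (C : Fin F → Fin K → Bool) : Prop where
  K_pos : 0 < K
  F_pos : 0 < F
  Z_pos : 0 < Z
  r_pos : 0 < r
  /-- Each column contains `Z` stars. -/
  card_star : ∀ k, (Finset.univ.filter fun j => C j k = true).card = Z
  /-- Two different columns at cyclic distance less than `r` have disjoint sets of stars. -/
  disjoint : ∀ (k : Fin K) (i : ℕ), i < r → cyclicAdd k i ≠ k →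
    ∀ j, ¬ (C j k = true ∧ C j (cyclicAdd k i) = true)

/-- `D` is a `(C, S, L)` delivery array, for a caching array `C` and access degree `r`. -/
structure IsDeliveryArray {K F : ℕ} (C : Fin F → Fin K → Bool) (r S L : ℕ)
    (D : Fin F → Fin K → Option (Fin S)) : Prop where
  S_pos : 0 < S
  L_pos : 0 < L
  /-- The stars of column `k` are those of the columns `k, k + 1, …, k + r - 1` (cyclically)
  of `C`. -/
  star : ∀ j k, D j k = none ↔ ∃ i, i < r ∧ C j (cyclicAdd k i) = true
  /-- Every integer occurs. -/
  occurs : ∀ s, ∃ j k, D j k = some s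
  /-- No integer appears more than once in a column. -/
  column : ∀ k s j₁ j₂, D j₁ k = some s → D j₂ k = some s → j₁ = j₂
  /-- In the sub-array of the rows and columns that contain `s`, each row has at most `L`
  integers. -/
  row : ∀ s j, (∃ k, D j k = some s) →
    (Finset.univ.filter fun k => (∃ i, D i k = some s) ∧ D j k ≠ none).card ≤ L

/-- The column that lies `i` places to the left of `k`, cyclically (for `i < K`). Shifting the
columns of an array from left to right `i` times puts the old column `cyclicSub k i` at place
`k`. -/
def cyclicSub {K : ℕ} (k : Fin K) (i : ℕ) : Fin K := cyclicAdd k (K - i)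

/-- The index of the block of `r` consecutive columns that contains the column `k`. -/
def blockIndex {r K' : ℕ} (k : Fin (r * K')) : Fin K' :=
  ⟨k.val / r, Nat.div_lt_of_lt_mul k.isLt⟩

section Construction

variable {K' F' S' : ℕ} (r : ℕ) (A : Fin F' → Fin K' → Option (Fin S'))

/-- The `F' × rK'` array whose column `k r` (counted from one) has the stars of the column `k`
of `A`, and whose other columns are null. -/
def cachingBlock (j : Fin F') (k : Fin (r * K')) : Bool :=
  decide (∃ m : Fin K', k.val + 1 = (m.val + 1) * r ∧ A j m = none)

/-- The `rF' × rK'` array obtained by stacking `cachingBlock` and its `r - 1` cyclic shifts: the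
row `q = i F' + j` is the row `j` of the `i`-th shift. -/
def cachingArrayOf (q : Fin (r * F')) (k : Fin (r * K')) : Bool :=
  cachingBlock r A q.modNat (cyclicSub k q.divNat)

/-- The `rF' × rK'` array obtained from `A` by repeating each column `r` times and stacking the
result with its `r - 1` cyclic shifts, where `i S'` is added to the integers of the `i`-th
shift. -/
def deliveryArrayOf (q : Fin (r * F')) (k : Fin (r * K')) : Option (Fin (r * S')) :=
  (A q.modNat (blockIndex (cyclicSub k q.divNat))).map fun s => finProdFinEquiv (q.divNat, s)

end Construction

/-! ## The cyclic wrap-around multi-access network -/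

/-- A file of `F * b` bits, divided into `F` subfiles of `b` bits each. -/
abbrev File (F b : ℕ) : Type := Fin F → Fin b → Bool

/-- A library of `N` files. -/
abbrev Library (N F b : ℕ) : Type := Fin N → File F b

/-- What a user knows of the library from the caches: some subfiles (`some`) and nothing about
the others (`none`). -/
abbrev SideInfo (N F b : ℕ) : Type := Fin N → Fin F → Option (Fin b → Bool)

/-- A channel realization: the vector of gains from the `L` antennas, for each of the users. -/
abbrev Channel (K L : ℕ) : Type := Fin K → Fin L → ℂ

/-- General position: the channel vectors of any `L` (or fewer) users are linearly
independent. -/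
def Channel.Generic {K L : ℕ} (h : Channel K L) : Prop :=
  ∀ U : Finset (Fin K), U.card ≤ L → LinearIndependent ℂ fun u : U => h u

/-- The circularly symmetric complex Gaussian distribution of mean `0` and variance `1`. -/
noncomputable def complexGaussian : Measure ℂ :=
  ((gaussianReal 0 (1 / 2)).prod (gaussianReal 0 (1 / 2))).map Complex.measurableEquivRealProd.symm

instance : IsProbabilityMeasure complexGaussian :=
  Measure.isProbabilityMeasure_map Complex.measurableEquivRealProd.symm.measurable.aemeasurable

/-- A multi-antenna coded caching scheme of subpacketization level `F` for `K` users, `K` caches,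
`L` antennas and `N` files, with uncoded placement. There is a delivery policy for every transmit
power `P`, subfile size `b` (so that files have `F * b` bits) and demand vector `d`. The delivery
consists of `numTx` transmissions, each of a number of channel uses, with the channel constant
during each transmission. The server encodes a transmission knowing the channel `h` during it;
the users decode at the end. -/
structure MACCScheme (K L N F : ℕ) where
  /-- The subfiles `(n, j)` (the `j`-th subfile of the `n`-th file) stored in each cache. -/
  cached : Fin K → Finset (Fin N × Fin F)
  /-- The number of transmissions. -/
  numTx : ℕ
  /-- The number of channel uses of each transmission. -/
  len : (P : ℝ) → (b : ℕ) → (d : Fin K → Fin N) → Fin numTx → Channel K L → ℕ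
  /-- The vectors sent in each transmission. -/
  encode : (P : ℝ) → (b : ℕ) → (d : Fin K → Fin N) → (s : Fin numTx) → (h : Channel K L) →
    Library N F b → Fin (len P b d s h) → Fin L → ℂ
  /-- The estimate made by a user of the demanded file, from the side information and from all
  that the user receives. -/
  decode : (P : ℝ) → (b : ℕ) → (d : Fin K → Fin N) → (H : Fin numTx → Channel K L) → Fin K →
    SideInfo N F b → ((s : Fin numTx) → Fin (len P b d s (H s)) → ℂ) → File F b
  measurable_decode : ∀ P b d H k I, Measurable (decode P b d H k I)

namespace MACCScheme

variable {K L N F : ℕ} (σ : MACCScheme K L N F)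

/-- Each cache stores at most `M` files' worth of subfiles. -/
def RespectsMemory (M : ℝ) : Prop := ∀ i, ((σ.cached i).card : ℝ) / F ≤ M

/-- For independent uniformly distributed files, `E ‖x‖² ≤ P` for every transmitted vector
`x`. -/
def RespectsPower : Prop :=
  ∀ (P : ℝ) (b : ℕ) (d : Fin K → Fin N) (s : Fin σ.numTx) (h : Channel K L)
    (τ : Fin (σ.len P b d s h)), 0 < P →
    (∑ W : Library N F b, ∑ a, ‖σ.encode P b d s h W τ a‖ ^ 2) /
      (Fintype.card (Library N F b) : ℝ) ≤ P

/-- The side information of the user `k`, who accesses the caches `k, k + 1, …, k + r - 1`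
(cyclically). -/
def sideInfo (r : ℕ) {b : ℕ} (W : Library N F b) (k : Fin K) : SideInfo N F b :=
  fun n j => if ∃ i ∈ Finset.range r, (n, j) ∈ σ.cached (cyclicAdd k i) then some (W n j) else none

/-- The signal received by the user `k` when the noise at that user is `z`. -/
noncomputable def received (P : ℝ) (b : ℕ) (d : Fin K → Fin N) (H : Fin σ.numTx → Channel K L)
    (W : Library N F b) (k : Fin K) (z : (s : Fin σ.numTx) → Fin (σ.len P b d s (H s)) → ℂ) :
    (s : Fin σ.numTx) → Fin (σ.len P b d s (H s)) → ℂ :=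
  fun s τ => (∑ a, H s k a * σ.encode P b d s (H s) W τ a) + z s τ

/-- The law of the noise at a user: independent standard complex Gaussians. -/
noncomputable def noise (P : ℝ) (b : ℕ) (d : Fin K → Fin N) (H : Fin σ.numTx → Channel K L) :
    Measure ((s : Fin σ.numTx) → Fin (σ.len P b d s (H s)) → ℂ) :=
  Measure.pi fun _ => Measure.pi fun _ => complexGaussian

/-- The probability, over independent uniformly distributed files and independent noise, that the
user `k` does not recover the demanded file. -/
noncomputable def errorProb (r : ℕ) (P : ℝ) (b : ℕ) (H : Fin σ.numTx → Channel K L)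
    (d : Fin K → Fin N) (k : Fin K) : ℝ :=
  (∑ W : Library N F b, (σ.noise P b d H).real
      {z | σ.decode P b d H k (σ.sideInfo r W k) (σ.received P b d H W k z) ≠ W (d k)}) /
    (Fintype.card (Library N F b) : ℝ)

/-- The worst-case probability of error, over all demand vectors and all users. -/
noncomputable def worstErrorProb (r : ℕ) (P : ℝ) (b : ℕ) (H : Fin σ.numTx → Channel K L) : ℝ :=
  ⨆ x : (Fin K → Fin N) × Fin K, σ.errorProb r P b H x.1 x.2

/-- In the high SNR regime, the worst-case probability of error tends to `0` as the file size
tends to infinity. -/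
def IsAchievable (r : ℕ) (H : Fin σ.numTx → Channel K L) : Prop :=
  ∀ᶠ P : ℝ in atTop, Tendsto (fun b : ℕ => σ.worstErrorProb r P b H) atTop (𝓝 0)

/-- The delivery time (number of channel uses) for the worst demand vector. -/
def deliveryTime (P : ℝ) (b : ℕ) (H : Fin σ.numTx → Channel K L) : ℕ :=
  Finset.univ.sup fun d : Fin K → Fin N => ∑ s, σ.len P b d s (H s)

/-- The normalized delivery time, the iterated limit as `P → ∞` of the limit as `B → ∞` of
`(max_d T(d)) / (B / log P)` with `B = F * b` bits, exists and equals `T`. -/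
def HasNormalizedDeliveryTime (H : Fin σ.numTx → Channel K L) (T : ℝ) : Prop :=
  ∃ g : ℝ → ℝ,
    (∀ᶠ P : ℝ in atTop, Tendsto
      (fun b : ℕ => (σ.deliveryTime P b H : ℝ) / ((F * b : ℝ) / Real.logb 2 P)) atTop (𝓝 (g P))) ∧
    Tendsto g atTop (𝓝 T)

end MACCScheme

/-- The placement described by an array: the cache `i` stores the `j`-th subfile of every file
if and only if the array has a star in the row `j` and the column `i`. -/
def placementOf {K F : ℕ} (N : ℕ) (C : Fin F → Fin K → Bool) (i : Fin K) :
    Finset (Fin N × Fin F) :=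
  Finset.univ.filter fun p => C p.2 i = true

/-! Arrays. In a row of the `i`-th shift, column `k` behaves like column `k - i` of the unshifted
block. A caching star requires `k - i` to end a block of `r` columns, which happens for exactly one
`i < r`; so all stars of column `k` lie in one shift, fixed by `k + 1` modulo `r`, and nearby
columns use different shifts (`cyclicSub_mod`). Conversely, any `r` consecutive columns from `k - i`
on contain exactly one block end, that of the block of `k - i` (`blockIndex_cyclicAdd`), so the
accessible stars are those of `A`. An integer lives in one shift only, where the delivery array is
`A` with columns repeated `r` times; this multiplies the row bound by `r`.

Scheme. Transmission `s` sends to each user whose column contains `s` the subfile of that row. The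
row condition says that at most `L` served users lack this subfile, so a generic channel lets it be
zero-forced at all of them but the intended one (`exists_zeroForcing`); the other served users
subtract it using their caches. Each served user is left with a Gaussian channel of nonzero gain
(`sum_encode_eq`).

Coding. That channel must carry about `log P` bits per use. A grid of `4 ^ ℓ` points with `ℓ ≈ (log
P) / 2 - log log P` is combined with a Gilbert–Varshamov code of relative Hamming distance `1 / ℓ`,
at rate `2 ℓ - 3` (`exists_complex_code`). The squared distance between words, at power `P`, is at
least of order `n P / (ℓ 4 ^ ℓ)`, which beats the noise energy `O(n)` since `ℓ 4 ^ ℓ / P → 0`; the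
noise exceeds its bound with probability at most `2 ^ (-n)` (`exists_noise_energy_bound`). Since
`log P / (2 ℓ - 3) → 1`, the `r S'` transmissions of subfiles of size `B / (r F')` give `S' / F'`.
-/

/-! ### Cyclic translations of the columns -/

section Cyclic

variable {K : ℕ}

theorem cyclicAdd_val (k : Fin K) (i : ℕ) : (cyclicAdd k i).val = (k.val + i) % K := rfl

theorem cyclicAdd_cyclicAdd (k : Fin K) (i j : ℕ) :
    cyclicAdd (cyclicAdd k i) j = cyclicAdd k (i + j) := by
  ext
  simp [cyclicAdd_val, Nat.mod_add_mod, add_assoc]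

theorem cyclicAdd_self (k : Fin K) : cyclicAdd k K = k := by
  ext
  simp [cyclicAdd_val, Nat.mod_eq_of_lt k.isLt]

theorem cyclicAdd_cyclicSub {i : ℕ} (k : Fin K) (hi : i ≤ K) :
    cyclicAdd (cyclicSub k i) i = k := by
  rw [cyclicSub, cyclicAdd_cyclicAdd, Nat.sub_add_cancel hi, cyclicAdd_self]

theorem cyclicSub_cyclicAdd {i : ℕ} (k : Fin K) (hi : i ≤ K) :
    cyclicSub (cyclicAdd k i) i = k := by
  rw [cyclicSub, cyclicAdd_cyclicAdd, Nat.add_sub_cancel' hi, cyclicAdd_self]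

theorem cyclicSub_cyclicAdd_comm (k : Fin K) (i j : ℕ) :
    cyclicSub (cyclicAdd k j) i = cyclicAdd (cyclicSub k i) j := by
  rw [cyclicSub, cyclicSub, cyclicAdd_cyclicAdd, cyclicAdd_cyclicAdd, add_comm]

theorem cyclicSub_injective {i : ℕ} (hi : i ≤ K) :
    Function.Injective fun k : Fin K => cyclicSub k i :=
  Function.LeftInverse.injective (g := fun k => cyclicAdd k i) fun k => cyclicAdd_cyclicSub k hi

end Cyclic

/-! ### The caching and delivery arrays of an EPDA -/

section Blocks

variable {K' F' S' r : ℕ}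

theorem cyclicAdd_mod (k : Fin (r * K')) (i : ℕ) : (cyclicAdd k i).val % r = (k.val + i) % r := by
  rw [cyclicAdd_val, Nat.mod_mul_right_mod]

theorem cachingBlock_eq_true (hr : 0 < r) (A : Fin F' → Fin K' → Option (Fin S'))
    (j : Fin F') (k : Fin (r * K')) :
    cachingBlock r A j k = true ↔ (k.val + 1) % r = 0 ∧ A j (blockIndex k) = none := by
  rw [cachingBlock, decide_eq_true_iff]
  constructor
  · rintro ⟨m, hm, hA⟩
    have hb : blockIndex k = m := by
      ext
      have : k.val = r * m.val + (r - 1) := by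
        have : (m.val + 1) * r = r * m.val + r := by ring
        omega
      simp only [blockIndex]
      rw [this, Nat.mul_add_div hr, Nat.div_eq_of_lt (by omega), add_zero]
    exact ⟨by simp [hm], hb ▸ hA⟩
  · rintro ⟨h, hA⟩
    refine ⟨_, ?_, hA⟩
    obtain ⟨c, hc⟩ := Nat.dvd_of_mod_eq_zero h
    obtain _ | c := c
    · simp at hc
    have h1 : k.val = r * c + (r - 1) := by
      have : r * (c + 1) = r * c + r := by ring
      omega
    simp only [blockIndex]
    rw [hc, h1, Nat.mul_add_div hr, Nat.div_eq_of_lt (by omega), add_zero, mul_comm]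

/-- Among the first `r` columns from `k` on, exactly the last one of the block of `k` ends a
block. -/
theorem blockIndex_cyclicAdd {i : ℕ} (hi : i < r) (k : Fin (r * K'))
    (h : ((cyclicAdd k i).val + 1) % r = 0) : blockIndex (cyclicAdd k i) = blockIndex k := by
  have hr : 0 < r := by omega
  have hdm := Nat.div_add_mod k.val r
  have hlt := Nat.mod_lt k.val hr
  have ha : k.val / r < K' := (blockIndex k).isLt
  have hmod : (k.val % r + i + 1) % r = 0 := by
    have h1 := cyclicAdd_mod k i
    rw [Nat.add_mod, h1, ← Nat.add_mod] at h
    rw [← h, add_assoc, add_assoc, Nat.mod_add_mod]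
  -- A positive multiple of `r` that is less than `2 r`.
  have hsum : k.val % r + i + 1 = r := by
    obtain ⟨c, hc⟩ := Nat.dvd_of_mod_eq_zero hmod
    have h1 : 0 < c := Nat.pos_of_ne_zero (by rintro rfl; omega)
    have h2 : c < 2 := by
      by_contra h2
      have := Nat.mul_le_mul_left r (not_lt.mp h2)
      omega
    obtain rfl : c = 1 := by omega
    omega
  -- The block of `k` ends before `r * K'`, so reaching its end never wraps around.
  have hKle : r * (k.val / r + 1) ≤ r * K' := Nat.mul_le_mul_left r ha
  have hexp : r * (k.val / r + 1) = r * (k.val / r) + r := by ring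
  have hval : (cyclicAdd k i).val = r * (k.val / r) + (r - 1) := by
    rw [cyclicAdd_val, Nat.mod_eq_of_lt (by omega)]
    omega
  ext
  simp only [blockIndex]
  rw [hval, Nat.mul_add_div hr, Nat.div_eq_of_lt (show r - 1 < r by omega), add_zero]

theorem exists_cyclicAdd_mod (hr : 0 < r) (k : Fin (r * K')) :
    ∃ i < r, ((cyclicAdd k i).val + 1) % r = 0 := by
  refine ⟨r - 1 - k.val % r, by omega, ?_⟩
  have hlt := Nat.mod_lt k.val hr
  rw [Nat.add_mod, cyclicAdd_mod, ← Nat.add_mod, add_assoc, ← Nat.mod_add_mod,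
    show k.val % r + (r - 1 - k.val % r + 1) = r by omega, Nat.mod_self]

theorem le_mul_of_fin (k : Fin (r * K')) : r ≤ r * K' := by
  have := k.isLt
  exact Nat.le_mul_of_pos_right r (Nat.pos_of_ne_zero (by rintro rfl; simp at this))

/-- Since `r` divides the number of columns, wrapping around preserves residues modulo `r`. Hence
exactly one shift can put stars in column `k`, which yields both the star count and the disjointness
of a caching array. -/
theorem cyclicSub_mod {i : ℕ} (hi : i < r) (k : Fin (r * K')) :
    ((cyclicSub k i).val + 1) % r = 0 ↔ i = (k.val + 1) % r := by
  have h1 := cyclicAdd_mod (cyclicSub k i) i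
  rw [cyclicAdd_cyclicSub k (hi.le.trans (le_mul_of_fin k))] at h1
  have h2 : (k.val + 1) ≡ (cyclicSub k i).val + 1 + i [MOD r] := by
    have : k.val ≡ (cyclicSub k i).val + i [MOD r] := h1
    have := this.add_right 1
    rwa [add_right_comm] at this
  constructor
  · intro h
    have h3 : (cyclicSub k i).val + 1 + i ≡ 0 + i [MOD r] := Nat.ModEq.add_right i h
    have h4 := h2.trans h3
    rw [zero_add] at h4
    rw [h4, Nat.mod_eq_of_lt hi]
  · intro h
    have h3 : 0 + i ≡ (cyclicSub k i).val + 1 + i [MOD r] := by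
      refine Nat.ModEq.trans ?_ h2
      rw [zero_add]
      conv_lhs => rw [h]
      exact Nat.mod_modEq _ _
    exact (Nat.ModEq.add_right_cancel' i h3).symm

theorem cachingArrayOf_eq_true (hr : 0 < r) (A : Fin F' → Fin K' → Option (Fin S'))
    (q : Fin (r * F')) (k : Fin (r * K')) :
    cachingArrayOf r A q k = true ↔ ((cyclicSub k q.divNat).val + 1) % r = 0 ∧
      A q.modNat (blockIndex (cyclicSub k q.divNat)) = none :=
  cachingBlock_eq_true hr A _ _

theorem deliveryArrayOf_eq_none (A : Fin F' → Fin K' → Option (Fin S'))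
    (q : Fin (r * F')) (k : Fin (r * K')) :
    deliveryArrayOf r A q k = none ↔ A q.modNat (blockIndex (cyclicSub k q.divNat)) = none := by
  simp [deliveryArrayOf]

theorem deliveryArrayOf_eq_some (A : Fin F' → Fin K' → Option (Fin S'))
    (q : Fin (r * F')) (k : Fin (r * K')) (s : Fin (r * S')) :
    deliveryArrayOf r A q k = some s ↔
      A q.modNat (blockIndex (cyclicSub k q.divNat)) = some s.modNat ∧ q.divNat = s.divNat := by
  obtain ⟨⟨i, t⟩, rfl⟩ := finProdFinEquiv.surjective s
  have h : ((finProdFinEquiv (i, t)).divNat, (finProdFinEquiv (i, t)).modNat) = (i, t) :=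
    finProdFinEquiv.symm_apply_apply (i, t)
  simp only [Prod.mk.injEq] at h
  rw [h.1, h.2, deliveryArrayOf, Option.map_eq_some_iff]
  constructor
  · rintro ⟨t', ht, h'⟩
    obtain ⟨h1, rfl⟩ := Prod.mk.inj (finProdFinEquiv.injective h')
    exact ⟨ht, h1⟩
  · rintro ⟨h1, h2⟩
    exact ⟨t, h1, by rw [h2]⟩

theorem divNat_finProdFinEquiv {m n : ℕ} (i : Fin m) (j : Fin n) :
    (finProdFinEquiv (i, j)).divNat = i :=
  congrArg Prod.fst (finProdFinEquiv.symm_apply_apply (i, j))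

theorem modNat_finProdFinEquiv {m n : ℕ} (i : Fin m) (j : Fin n) :
    (finProdFinEquiv (i, j)).modNat = j :=
  congrArg Prod.snd (finProdFinEquiv.symm_apply_apply (i, j))

theorem Fin.eq_of_divNat_of_modNat {m n : ℕ} {p q : Fin (m * n)} (h1 : p.divNat = q.divNat)
    (h2 : p.modNat = q.modNat) : p = q :=
  finProdFinEquiv.symm.injective (Prod.ext h1 h2)

theorem card_filter_blockIndex (r : ℕ) (m : Fin K') :
    (Finset.univ.filter fun k : Fin (r * K') => blockIndex k = m).card ≤ r := by
  rw [← Finset.card_map Fin.valEmbedding]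
  calc _ ≤ (Finset.Ico (r * m.val) (r * m.val + r)).card := by
        refine Finset.card_le_card fun x hx => ?_
        obtain ⟨k, hk, rfl⟩ := Finset.mem_map.mp hx
        have h := congrArg Fin.val (Finset.mem_filter.mp hk).2
        simp only [blockIndex] at h
        have hr : 0 < r := Nat.pos_of_ne_zero (by rintro rfl; simpa using k.isLt)
        have hdm := Nat.div_add_mod k.val r
        have := Nat.mod_lt k.val hr
        rw [h] at hdm
        simp only [Fin.valEmbedding_apply, Finset.mem_Ico]
        omega
    _ = r := by simp

variable {L' Z' : ℕ} {A : Fin F' → Fin K' → Option (Fin S')}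

theorem IsEPDA.isCachingArray (hr : 0 < r) (hA : IsEPDA K' L' F' Z' S' A) :
    IsCachingArray (r * K') (r * F') Z' r (cachingArrayOf r A) where
  K_pos := Nat.mul_pos hr hA.K_pos
  F_pos := Nat.mul_pos hr hA.F_pos
  Z_pos := hA.Z_pos
  r_pos := hr
  card_star k := by
    have hlt : (k.val + 1) % r < r := Nat.mod_lt _ hr
    rw [← hA.card_star (blockIndex (cyclicSub k ((k.val + 1) % r)))]
    symm
    refine Finset.card_bij (fun j _ => finProdFinEquiv (⟨(k.val + 1) % r, hlt⟩, j)) ?_ ?_ ?_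
    · intro j hj
      rw [Finset.mem_filter, cachingArrayOf_eq_true hr, divNat_finProdFinEquiv,
        modNat_finProdFinEquiv]
      exact ⟨Finset.mem_univ _, (cyclicSub_mod hlt k).mpr rfl, (Finset.mem_filter.mp hj).2⟩
    · intro j _ j' _ h
      exact (Prod.mk.inj (finProdFinEquiv.injective h)).2
    · intro q hq
      rw [Finset.mem_filter, cachingArrayOf_eq_true hr, cyclicSub_mod q.divNat.isLt] at hq
      obtain ⟨-, h1, h2⟩ := hq
      rw [h1] at h2
      refine ⟨q.modNat, by simpa using h2, ?_⟩
      refine Fin.eq_of_divNat_of_modNat ?_ ?_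
      · rw [divNat_finProdFinEquiv]
        exact Fin.ext h1.symm
      · rw [modNat_finProdFinEquiv]
  disjoint k i hi hne q h := by
    rw [cachingArrayOf_eq_true hr, cachingArrayOf_eq_true hr, cyclicSub_mod q.divNat.isLt,
      cyclicSub_mod q.divNat.isLt] at h
    -- Both stars lie in the shift of `q`, so the residues of the two columns agree; then `r`
    -- divides `i < r`, and the columns coincide.
    refine hne ?_
    have h1 := h.1.1.symm.trans h.2.1
    have h2 : k.val + 1 ≡ k.val + 1 + i [MOD r] := by
      have : (cyclicAdd k i).val + 1 ≡ k.val + i + 1 [MOD r] :=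
        Nat.ModEq.add_right 1 (cyclicAdd_mod k i)
      rw [add_right_comm] at this
      exact Nat.ModEq.trans h1 this
    have h3 : i % r = 0 := by
      have : k.val + 1 + 0 ≡ k.val + 1 + i [MOD r] := h2
      have := Nat.ModEq.add_left_cancel' _ this
      exact this.symm
    rw [Nat.mod_eq_of_lt hi] at h3
    subst h3
    ext
    simp [cyclicAdd_val, Nat.mod_eq_of_lt k.isLt]

/-- The offsets `i S'` keep the integers of different shifts apart, so each condition on an integer
concerns a single shift and reduces to the same condition on `A`. -/
theorem IsEPDA.isDeliveryArray (hr : 0 < r) (hA : IsEPDA K' L' F' Z' S' A) :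
    IsDeliveryArray (cachingArrayOf r A) r (r * S') (r * L') (deliveryArrayOf r A) where
  S_pos := Nat.mul_pos hr hA.S_pos
  L_pos := Nat.mul_pos hr hA.L_pos
  star q k := by
    rw [deliveryArrayOf_eq_none]
    constructor
    · intro h
      obtain ⟨i, hi, hmod⟩ := exists_cyclicAdd_mod hr (cyclicSub k q.divNat)
      refine ⟨i, hi, ?_⟩
      rw [cachingArrayOf_eq_true hr, cyclicSub_cyclicAdd_comm, blockIndex_cyclicAdd hi _ hmod]
      exact ⟨hmod, h⟩
    · rintro ⟨i, hi, h⟩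
      rw [cachingArrayOf_eq_true hr, cyclicSub_cyclicAdd_comm] at h
      rw [← blockIndex_cyclicAdd hi _ h.1]
      exact h.2
  occurs s := by
    obtain ⟨j, m, hjm⟩ := hA.occurs s.modNat
    have hm : r * m.val < r * K' := Nat.mul_lt_mul_of_pos_left m.isLt hr
    have hb : blockIndex (⟨r * m.val, hm⟩ : Fin (r * K')) = m :=
      Fin.ext (Nat.mul_div_cancel_left _ hr)
    refine ⟨finProdFinEquiv (s.divNat, j), cyclicAdd ⟨r * m.val, hm⟩ s.divNat, ?_⟩
    rw [deliveryArrayOf_eq_some, divNat_finProdFinEquiv, modNat_finProdFinEquiv,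
      cyclicSub_cyclicAdd _ (s.divNat.isLt.le.trans (le_mul_of_fin ⟨r * m.val, hm⟩)), hb]
    exact ⟨hjm, rfl⟩
  column k s q₁ q₂ h₁ h₂ := by
    rw [deliveryArrayOf_eq_some] at h₁ h₂
    have hd : q₁.divNat = q₂.divNat := h₁.2.trans h₂.2.symm
    refine Fin.eq_of_divNat_of_modNat hd ?_
    rw [← hd] at h₂
    exact hA.column _ _ _ _ h₁.1 h₂.1
  row s q hq := by
    obtain ⟨k₀, hk₀⟩ := hq
    rw [deliveryArrayOf_eq_some] at hk₀
    have hrow := hA.row s.modNat q.modNat ⟨_, hk₀.1⟩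
    -- The columns counted map to blocks counted by the row condition of `A`, with at most `r`
    -- columns over each block.
    refine le_trans ?_ (Nat.mul_le_mul_left r hrow)
    refine Finset.card_le_mul_card_image_of_maps_to
      (f := fun k => blockIndex (cyclicSub k s.divNat)) ?_ r ?_
    · intro k hk
      obtain ⟨⟨p, hp⟩, hne⟩ := (Finset.mem_filter.mp hk).2
      rw [deliveryArrayOf_eq_some] at hp
      rw [ne_eq, deliveryArrayOf_eq_none, hk₀.2] at hne
      rw [hp.2] at hp
      exact Finset.mem_filter.mpr ⟨Finset.mem_univ _, ⟨_, hp.1⟩, hne⟩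
    · intro m _
      refine le_trans ?_ (card_filter_blockIndex r m)
      refine Finset.card_le_card_of_injOn (fun k => cyclicSub k s.divNat) ?_ ?_
      · intro k hk
        simp only [Finset.coe_filter, Set.mem_ofPred_eq, Finset.mem_filter] at hk ⊢
        exact ⟨Finset.mem_univ _, hk.2⟩
      · exact (cyclicSub_injective (s.divNat.isLt.le.trans (le_mul_of_fin k₀))).injOn

end Blocks

/-! ### Well-separated codes over a complex grid -/

section Codes

/-- A Hamming ball of radius `d` in `αⁿ` has at most `2ⁿ |α|ᵈ` elements. -/
theorem card_hammingBall_le {α : Type*} [Fintype α] [DecidableEq α] [Nonempty α] {n : ℕ} (d : ℕ)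
    (x : Fin n → α) :
    (Finset.univ.filter fun y => hammingDist x y ≤ d).card ≤ 2 ^ n * Fintype.card α ^ d := by
  let T : Finset (Finset (Fin n)) := Finset.univ.filter fun t => t.card ≤ d
  -- The words that agree with `x` outside `t`.
  let B : Finset (Fin n) → Finset (Fin n → α) := fun t =>
    Fintype.piFinset fun i => if i ∈ t then Finset.univ else {x i}
  have hsub : (Finset.univ.filter fun y => hammingDist x y ≤ d) ⊆ T.biUnion B := by
    intro y hy
    refine Finset.mem_biUnion.mpr ⟨Finset.univ.filter fun i => x i ≠ y i,
      Finset.mem_filter.mpr ⟨Finset.mem_univ _, (Finset.mem_filter.mp hy).2⟩, ?_⟩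
    refine Fintype.mem_piFinset.mpr fun i => ?_
    by_cases h : x i = y i
    · simp [h]
    · simp [h]
  have hB : ∀ t ∈ T, (B t).card ≤ Fintype.card α ^ d := by
    intro t ht
    have h1 : (B t).card = Fintype.card α ^ t.card := by
      simp only [B, Fintype.card_piFinset]
      rw [Finset.prod_congr rfl fun i _ => apply_ite Finset.card _ _ _]
      simp
    rw [h1]
    exact Nat.pow_le_pow_right Fintype.card_pos (Finset.mem_filter.mp ht).2
  calc _ ≤ (T.biUnion B).card := Finset.card_le_card hsub
    _ ≤ T.card * Fintype.card α ^ d := Finset.card_biUnion_le_card_mul _ _ _ hB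
    _ ≤ 2 ^ n * Fintype.card α ^ d := by
        refine Nat.mul_le_mul_right _ ?_
        calc T.card ≤ Fintype.card (Finset (Fin n)) := Finset.card_le_univ _
          _ = 2 ^ n := by simp

/-- A Gilbert–Varshamov bound. -/
theorem exists_code_hammingDist {α β : Type*} [Fintype α] [DecidableEq α] [Nonempty α] [Fintype β]
    (n d : ℕ) (h : Fintype.card β * (2 ^ n * Fintype.card α ^ d) ≤ Fintype.card α ^ n) :
    ∃ c : β → Fin n → α, ∀ w w', w ≠ w' → d < hammingDist (c w) (c w') := by
  let Sep : Finset (Fin n → α) → Prop := fun C => ∀ x ∈ C, ∀ y ∈ C, x ≠ y → d < hammingDist x y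
  have : Nonempty {C // Sep C} := ⟨⟨∅, by simp [Sep]⟩⟩
  -- A separated set of maximal size: no word can be added, so the balls of radius `d` around it
  -- cover everything.
  obtain ⟨⟨C, hC⟩, hmax⟩ := Finite.exists_max fun C : {C // Sep C} => C.1.card
  have hcover : ∀ y, ∃ x ∈ C, hammingDist x y ≤ d := by
    intro y
    by_contra! hy
    have hyC : y ∉ C := fun hyC => by simpa using hy y hyC
    have hS : Sep (insert y C) := by
      intro u hu v hv huv
      rcases Finset.mem_insert.mp hu with hu | hu <;> rcases Finset.mem_insert.mp hv with hv | hv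
      · exact absurd (hu.trans hv.symm) huv
      · rw [hu, hammingDist_comm]
        exact hy v hv
      · rw [hv]
        exact hy u hu
      · exact hC u hu v hv huv
    have := hmax ⟨_, hS⟩
    simp [Finset.card_insert_of_notMem hyC] at this
  have hcard : Fintype.card α ^ n ≤ C.card * (2 ^ n * Fintype.card α ^ d) := by
    calc Fintype.card α ^ n = (Finset.univ : Finset (Fin n → α)).card := by simp
      _ ≤ (C.biUnion fun x => Finset.univ.filter fun y => hammingDist x y ≤ d).card := by
          refine Finset.card_le_card fun y _ => ?_
          obtain ⟨x, hx, hxy⟩ := hcover y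
          exact Finset.mem_biUnion.mpr ⟨x, hx, Finset.mem_filter.mpr ⟨Finset.mem_univ _, hxy⟩⟩
      _ ≤ _ := Finset.card_biUnion_le_card_mul _ _ _ fun x _ => card_hammingBall_le d x
  have hle : Fintype.card β ≤ Fintype.card C := by
    rw [Fintype.card_coe]
    have hpos : 0 < Fintype.card α := Fintype.card_pos
    exact Nat.le_of_mul_le_mul_right (h.trans hcard) (by positivity)
  obtain ⟨e⟩ := Function.Embedding.nonempty_of_card_le hle
  exact ⟨fun w => e w, fun w w' hw => hC _ (e w).2 _ (e w').2 fun h =>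
    hw (e.injective (Subtype.ext h))⟩

/-- The points `(x + y i) / 2 ^ (ℓ + 1)` of a square grid in the unit disc. -/
noncomputable def gridPoint (ℓ : ℕ) (p : Fin (2 ^ ℓ) × Fin (2 ^ ℓ)) : ℂ :=
  ⟨(p.1.val : ℝ) / 2 ^ (ℓ + 1), (p.2.val : ℝ) / 2 ^ (ℓ + 1)⟩

theorem norm_gridPoint_le (ℓ : ℕ) (p : Fin (2 ^ ℓ) × Fin (2 ^ ℓ)) : ‖gridPoint ℓ p‖ ≤ 1 := by
  have key : ∀ x : Fin (2 ^ ℓ), |(x.val : ℝ) / 2 ^ (ℓ + 1)| ≤ 1 / 2 := by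
    intro x
    rw [abs_of_nonneg (by positivity), div_le_iff₀ (by positivity), pow_succ]
    have : (x.val : ℝ) ≤ 2 ^ ℓ := by exact_mod_cast x.isLt.le
    linarith
  refine (Complex.norm_le_abs_re_add_abs_im _).trans ?_
  have h1 := key p.1
  have h2 := key p.2
  simp only [gridPoint]
  linarith

/-- Distinct points differ by at least one grid step `2 ^ (-(ℓ + 1))` in some coordinate. -/
theorem le_norm_gridPoint_sub (ℓ : ℕ) {p q : Fin (2 ^ ℓ) × Fin (2 ^ ℓ)} (h : p ≠ q) :
    1 ≤ 4 ^ (ℓ + 1) * ‖gridPoint ℓ p - gridPoint ℓ q‖ ^ 2 := by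
  have key : ∀ x y : Fin (2 ^ ℓ), x ≠ y →
      1 ≤ (4 : ℝ) ^ (ℓ + 1) * |(x.val : ℝ) / 2 ^ (ℓ + 1) - (y.val : ℝ) / 2 ^ (ℓ + 1)| ^ 2 := by
    intro x y hxy
    have h1 : (1 : ℝ) ≤ ((x.val : ℝ) - y.val) ^ 2 := by
      have h0 : ((x.val : ℤ) - y.val) ≠ 0 := by
        rw [sub_ne_zero]
        exact_mod_cast Fin.val_ne_of_ne hxy
      have : (1 : ℤ) ≤ ((x.val : ℤ) - y.val) ^ 2 := Int.add_one_le_of_lt (lt_of_le_of_ne (sq_nonneg _) (pow_ne_zero 2 h0).symm)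
      exact_mod_cast this
    rw [sq_abs, ← sub_div, div_pow, ← pow_mul, mul_comm (ℓ + 1), pow_mul]
    norm_num
    rw [mul_div_cancel₀ _ (by positivity)]
    exact h1
  have hmono : ∀ t : ℝ, |t| ≤ ‖gridPoint ℓ p - gridPoint ℓ q‖ → (4 : ℝ) ^ (ℓ + 1) * |t| ^ 2 ≤
      4 ^ (ℓ + 1) * ‖gridPoint ℓ p - gridPoint ℓ q‖ ^ 2 := fun t ht => by gcongr
  by_cases h1 : p.1 = q.1
  · have h2 : p.2 ≠ q.2 := fun h2 => h (Prod.ext h1 h2)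
    exact (key _ _ h2).trans (hmono _ (Complex.abs_im_le_norm (gridPoint ℓ p - gridPoint ℓ q)))
  · exact (key _ _ h1).trans (hmono _ (Complex.abs_re_le_norm (gridPoint ℓ p - gridPoint ℓ q)))

/-- Codes with `2 ^ b` words of length `n` over a grid of `4 ^ ℓ` points in the unit disc. -/
theorem exists_complex_code (ℓ b n : ℕ) :
    ∃ c : (Fin b → Bool) → Fin n → ℂ, (∀ w τ, ‖c w τ‖ ≤ 1) ∧
      (0 < ℓ → b + 3 * n ≤ 2 * ℓ * n → ∀ w w', w ≠ w' →
        (n : ℝ) ≤ ℓ * 4 ^ (ℓ + 1) * ∑ τ, ‖c w τ - c w' τ‖ ^ 2) := by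
  by_cases hyp : 0 < ℓ ∧ b + 3 * n ≤ 2 * ℓ * n
  swap
  · exact ⟨0, by simp, fun h1 h2 => absurd ⟨h1, h2⟩ hyp⟩
  obtain ⟨hℓ, h⟩ := hyp
  -- With radius `n / ℓ`, a ball has at most `2 ^ n * 4 ^ (ℓ * (n / ℓ)) ≤ 2 ^ (3 * n)` words: the
  -- distance costs only three bits per symbol.
  obtain ⟨c, hc⟩ := exists_code_hammingDist (α := Fin (2 ^ ℓ) × Fin (2 ^ ℓ)) (β := Fin b → Bool)
    n (n / ℓ) (by
      have hq : Fintype.card (Fin (2 ^ ℓ) × Fin (2 ^ ℓ)) = 2 ^ (2 * ℓ) := by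
        simp [two_mul, pow_add]
      rw [hq]
      simp only [Fintype.card_pi, Fintype.card_bool, Finset.prod_const, Finset.card_univ,
        Fintype.card_fin]
      rw [← pow_mul, ← pow_mul, ← pow_add, ← pow_add]
      refine Nat.pow_le_pow_right (by norm_num) ?_
      have := Nat.mul_div_le n ℓ
      have e : 2 * ℓ * (n / ℓ) = 2 * (ℓ * (n / ℓ)) := by ring
      omega)
  refine ⟨fun w τ => gridPoint ℓ (c w τ), fun w τ => norm_gridPoint_le _ _, fun _ _ w w' hw => ?_⟩
  have h1 : (hammingDist (c w) (c w') : ℝ) ≤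
      4 ^ (ℓ + 1) * ∑ τ, ‖gridPoint ℓ (c w τ) - gridPoint ℓ (c w' τ)‖ ^ 2 := by
    rw [hammingDist, Finset.card_filter, Finset.mul_sum]
    push_cast
    refine Finset.sum_le_sum fun τ _ => ?_
    split_ifs with hτ
    · exact le_norm_gridPoint_sub ℓ hτ
    · positivity
  have h2 : n ≤ ℓ * hammingDist (c w) (c w') :=
    (Nat.lt_mul_div_succ n hℓ).le.trans (Nat.mul_le_mul_left ℓ (hc w w' hw))
  calc (n : ℝ) ≤ ℓ * hammingDist (c w) (c w') := by exact_mod_cast h2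
    _ ≤ _ := by
      rw [mul_assoc]
      gcongr

end Codes

/-! ### Large deviations of the noise energy -/

section Noise

/-- Fernique's theorem for the independent real and imaginary parts. -/
theorem exists_integrable_exp_sq_complexGaussian :
    ∃ C, 0 < C ∧ Integrable (fun z => Real.exp (C * ‖z‖ ^ 2)) complexGaussian := by
  obtain ⟨C, hC, hint⟩ := IsGaussian.exists_integrable_exp_sq (gaussianReal 0 (1 / 2))
  refine ⟨C, hC, ?_⟩
  rw [complexGaussian, integrable_map_equiv]
  refine (hint.mul_prod hint).congr (ae_of_all _ fun p => ?_)
  simp only [Function.comp_apply]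
  rw [← Real.exp_add, ← mul_add, Complex.sq_norm, Complex.normSq_apply]
  simp [Complex.measurableEquivRealProd, sq]

/-- The total energy of the noise is at most linear in the block length, with high probability. -/
theorem exists_noise_energy_bound : ∃ a : ℝ, 0 < a ∧ ∀ n : ℕ,
    (Measure.pi fun _ : Fin n => complexGaussian).real {z | a * n ≤ ∑ τ, ‖z τ‖ ^ 2} ≤
      (1 / 2) ^ n := by
  obtain ⟨C, hC, hint⟩ := exists_integrable_exp_sq_complexGaussian
  set m := ∫ z, Real.exp (C * ‖z‖ ^ 2) ∂complexGaussian with hm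
  have hm0 : 0 ≤ m := integral_nonneg fun z => (Real.exp_pos _).le
  -- Chernoff's bound: at level `(2 * m + 1) / C` per symbol, Markov's inequality gives the
  -- probability `(m / exp (2 * m + 1)) ^ n`, and this inequality makes the base at most `1 / 2`.
  have hexp : 2 * m ≤ Real.exp (2 * m + 1) := by
    have := Real.add_one_le_exp (2 * m + 1)
    linarith
  refine ⟨(2 * m + 1) / C, by positivity, fun n => ?_⟩
  have hprod := Integrable.fintype_prod (ι := Fin n) (μ := fun _ => complexGaussian)
    (f := fun _ z => Real.exp (C * ‖z‖ ^ 2)) fun _ => hint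
  have h := mul_meas_ge_le_integral_of_nonneg (ae_of_all _ fun z => Finset.prod_nonneg
    fun i _ => (Real.exp_pos _).le) hprod (Real.exp ((2 * m + 1) * n))
  rw [integral_fintype_prod_eq_pow (ι := Fin n) (𝕜 := ℝ) (μ := complexGaussian)
    (fun z => Real.exp (C * ‖z‖ ^ 2)), Fintype.card_fin, ← hm] at h
  have hset : {z : Fin n → ℂ | (2 * m + 1) / C * n ≤ ∑ τ, ‖z τ‖ ^ 2} =
      {z | Real.exp ((2 * m + 1) * n) ≤ ∏ i, Real.exp (C * ‖z i‖ ^ 2)} := by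
    ext z
    simp only [Set.mem_ofPred_eq]
    rw [← Real.exp_sum, Real.exp_le_exp, ← Finset.mul_sum, div_mul_eq_mul_div, div_le_iff₀' hC]
  rw [hset]
  rw [mul_comm _ (n : ℝ), Real.exp_nat_mul] at h ⊢
  set x := (Measure.pi fun _ : Fin n => complexGaussian).real
    {z | Real.exp (2 * m + 1) ^ n ≤ ∏ i, Real.exp (C * ‖z i‖ ^ 2)} with hx
  have h3 : (2 * m) ^ n ≤ Real.exp (2 * m + 1) ^ n := pow_le_pow_left₀ (by positivity) hexp n
  have hE : 0 < Real.exp (2 * m + 1) ^ n := by positivity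
  have h4 : Real.exp (2 * m + 1) ^ n * (2 ^ n * x) ≤ Real.exp (2 * m + 1) ^ n * 1 := by
    calc _ = 2 ^ n * (Real.exp (2 * m + 1) ^ n * x) := by ring
      _ ≤ 2 ^ n * m ^ n := by gcongr
      _ = (2 * m) ^ n := by rw [mul_pow]
      _ ≤ _ := by rw [mul_one]; exact h3
  have h5 := le_of_mul_le_mul_left h4 hE
  rw [div_pow, one_pow, le_div_iff₀ (by positivity), mul_comm]
  exact h5

end Noise

/-! ### Zero-forcing -/

/-- A beamforming vector for the user `u` that is not heard by the other users of `U`. -/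
theorem exists_zeroForcing {K L : ℕ} (h : Channel K L) {ε : ℝ} (hε : 0 < ε) (U : Finset (Fin K))
    (u : Fin K) :
    ∃ v : Fin L → ℂ, (∀ a, ‖v a‖ ≤ ε) ∧ (h.Generic → U.card ≤ L → u ∈ U →
      ∑ a, h u a * v a ≠ 0 ∧ ∀ k ∈ U, k ≠ u → ∑ a, h k a * v a = 0) := by
  by_cases hyp : h.Generic ∧ U.card ≤ L ∧ u ∈ U
  swap
  · exact ⟨0, by simp [hε.le], fun h1 h2 h3 => absurd ⟨h1, h2, h3⟩ hyp⟩
  obtain ⟨hg, hU, hu⟩ := hyp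
  have hli := hg U hU
  -- Independence places `h u` outside the span of the other channel vectors of `U`. A functional
  -- that kills this span but not `h u` has the beam as its coefficient vector.
  have hnot := hli.notMem_span_image (s := {x | x ≠ ⟨u, hu⟩}) (x := ⟨u, hu⟩) (by simp)
  obtain ⟨f, hf, hker⟩ := Submodule.exists_le_ker_of_notMem hnot
  set v₀ : Fin L → ℂ := fun a => f (Pi.single a 1) with hv₀
  have hfv : ∀ k, ∑ a, h k a * v₀ a = f (h k) := by
    intro k
    rw [LinearMap.pi_apply_eq_sum_univ f (h k)]
    simp only [hv₀, smul_eq_mul]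
    refine Finset.sum_congr rfl fun a _ => ?_
    congr 2
    ext i
    simp [Pi.single_apply, eq_comm]
  have hN : 0 < ‖v₀‖ + 1 := by positivity
  set ρ : ℝ := ε / (‖v₀‖ + 1) with hρ
  have hρ0 : 0 < ρ := by positivity
  have hsum : ∀ k, ∑ a, h k a * (ρ * v₀ a) = ρ * f (h k) := by
    intro k
    rw [← hfv, Finset.mul_sum]
    exact Finset.sum_congr rfl fun a _ => by ring
  refine ⟨fun a => ρ * v₀ a, fun a => ?_, fun _ _ _ => ⟨?_, fun k hk hku => ?_⟩⟩
  · rw [norm_mul, Complex.norm_real, Real.norm_of_nonneg hρ0.le, hρ, div_mul_eq_mul_div,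
      div_le_iff₀ hN]
    have := norm_le_pi_norm v₀ a
    gcongr
    linarith
  · rw [hsum]
    exact mul_ne_zero (by exact_mod_cast hρ0.ne') hf
  · rw [hsum]
    have : f (h k) = 0 := hker (Submodule.subset_span ⟨⟨k, hk⟩, by simpa using hku, rfl⟩)
    rw [this, mul_zero]

/-! ### Choice of the rate at high power -/

section Rate

/-- The number of bits per real dimension that are sent at transmit power `P`. -/
noncomputable def bitsPerDim (P : ℝ) : ℕ :=
  ⌊Real.logb 2 P / 2 - Real.logb 2 (Real.logb 2 P)⌋₊

theorem tendsto_logb_two_atTop : Tendsto (Real.logb 2) atTop atTop :=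
  Real.tendsto_logb_atTop (by norm_num)

theorem tendsto_logb_div_self : Tendsto (fun x : ℝ => Real.logb 2 x / x) atTop (𝓝 0) := by
  have h := (Real.isLittleO_log_id_atTop.tendsto_div_nhds_zero).div_const (Real.log 2)
  simp only [zero_div, id] at h
  refine h.congr fun x => ?_
  rw [Real.logb, div_right_comm]

/-- Neither the correction `log log P` nor the rounding matters against `log P`. -/
theorem tendsto_bitsPerDim_div :
    Tendsto (fun P => (bitsPerDim P : ℝ) / Real.logb 2 P) atTop (𝓝 (1 / 2)) := by
  have hx : Tendsto (fun x : ℝ => (x / 2 - Real.logb 2 x) / x) atTop (𝓝 (1 / 2)) := by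
    have h := tendsto_logb_div_self.const_sub (1 / 2)
    rw [sub_zero] at h
    refine h.congr' ?_
    filter_upwards [eventually_gt_atTop 0] with x hx
    field_simp
  have hx' : Tendsto (fun x : ℝ => x / 2 - Real.logb 2 x) atTop atTop := by
    refine (hx.pos_mul_atTop (by norm_num) tendsto_id).congr' ?_
    filter_upwards [eventually_gt_atTop 0] with x hx
    simp only [id]
    field_simp
  have hfl : Tendsto (fun x : ℝ => (⌊x / 2 - Real.logb 2 x⌋₊ : ℝ) / x) atTop (𝓝 (1 / 2)) := by
    have h := ((tendsto_nat_floor_div_atTop (R := ℝ)).comp hx').mul hx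
    rw [one_mul] at h
    refine h.congr' ?_
    filter_upwards [hx'.eventually_gt_atTop 0] with x h0
    exact div_mul_div_cancel₀ h0.ne'
  exact hfl.comp tendsto_logb_two_atTop

theorem eventually_le_bitsPerDim : ∀ᶠ P in atTop, 2 ≤ bitsPerDim P := by
  have h : Tendsto (fun P => (bitsPerDim P : ℝ)) atTop atTop := by
    refine (tendsto_bitsPerDim_div.pos_mul_atTop (by norm_num) tendsto_logb_two_atTop).congr' ?_
    filter_upwards [tendsto_logb_two_atTop.eventually_gt_atTop 0] with P hP
    field_simp
  filter_upwards [h.eventually_ge_atTop 2] with P hP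
  exact_mod_cast hP

/-- The rate `2 ℓ - 3` has full multiplexing gain. -/
theorem tendsto_logb_div_rate :
    Tendsto (fun P => Real.logb 2 P / (2 * bitsPerDim P - 3)) atTop (𝓝 1) := by
  have h3 : Tendsto (fun P => 3 / Real.logb 2 P) atTop (𝓝 0) :=
    tendsto_const_nhds.div_atTop tendsto_logb_two_atTop
  have h := ((tendsto_bitsPerDim_div.const_mul 2).sub h3).inv₀ (by norm_num)
  norm_num at h
  refine h.congr' ?_
  filter_upwards [tendsto_logb_two_atTop.eventually_gt_atTop 0] with P hP
  rw [← mul_div_assoc, ← sub_div, inv_div]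

/-- This is what the `log log P` in `bitsPerDim` is for: it gives `4 ^ ℓ ≤ P / (log P) ^ 2`, which
absorbs the factor `ℓ ≤ log P` and leaves `1 / log P`. -/
theorem tendsto_bitsPerDim_mul_pow_div :
    Tendsto (fun P => (bitsPerDim P : ℝ) * 4 ^ bitsPerDim P / P) atTop (𝓝 0) := by
  refine tendsto_of_tendsto_of_tendsto_of_le_of_le' tendsto_const_nhds
    (tendsto_inv_atTop_zero.comp tendsto_logb_two_atTop) ?_ ?_
  · filter_upwards [eventually_gt_atTop 0] with P hP
    positivity
  · filter_upwards [eventually_gt_atTop 0, tendsto_logb_two_atTop.eventually_gt_atTop 1,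
      eventually_le_bitsPerDim] with P hP hlog hbits
    set x := Real.logb 2 P with hx
    have hx0 : 0 < x := by linarith
    have hlogx : 0 < Real.logb 2 x := Real.logb_pos (by norm_num) hlog
    -- The natural floor truncates negative numbers to `0`, excluded here by `2 ≤ bitsPerDim P`.
    have hnn : 0 ≤ x / 2 - Real.logb 2 x := by
      by_contra! hneg
      have : bitsPerDim P = 0 := Nat.floor_of_nonpos hneg.le
      omega
    have hle : (bitsPerDim P : ℝ) ≤ x / 2 - Real.logb 2 x := Nat.floor_le hnn
    have hlx : (bitsPerDim P : ℝ) ≤ x := by linarith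
    have hpow : (4 : ℝ) ^ bitsPerDim P ≤ P / x ^ 2 := by
      calc (4 : ℝ) ^ bitsPerDim P = (2 : ℝ) ^ (2 * (bitsPerDim P : ℝ)) := by
            rw [Real.rpow_mul (by norm_num), Real.rpow_natCast]
            norm_num
        _ ≤ (2 : ℝ) ^ (x - (Real.logb 2 x + Real.logb 2 x)) :=
            Real.rpow_le_rpow_of_exponent_le (by norm_num) (by linarith)
        _ = P / x ^ 2 := by
            rw [Real.rpow_sub (by norm_num), Real.rpow_add (by norm_num), hx,
              Real.rpow_logb (by norm_num) (by norm_num) hP, ← hx,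
              Real.rpow_logb (by norm_num) (by norm_num) hx0, sq]
    simp only [Function.comp_apply]
    rw [div_le_iff₀ hP]
    calc (bitsPerDim P : ℝ) * 4 ^ bitsPerDim P ≤ x * (P / x ^ 2) := by gcongr
      _ = x⁻¹ * P := by field_simp

/-- The length of the codes that carry `b` bits at transmit power `P`. -/
noncomputable def codeLength (P : ℝ) (b : ℕ) : ℕ := ⌈(2 * (bitsPerDim P : ℝ) - 3)⁻¹ * b⌉₊

/-- The rate condition under which the words of `exists_complex_code` are separated. -/
theorem add_codeLength_le {P : ℝ} (hP : 2 ≤ bitsPerDim P) (b : ℕ) :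
    b + 3 * codeLength P b ≤ 2 * bitsPerDim P * codeLength P b := by
  have hR : (0 : ℝ) < 2 * bitsPerDim P - 3 := by
    have : (2 : ℝ) ≤ bitsPerDim P := by exact_mod_cast hP
    linarith
  have h : (2 * (bitsPerDim P : ℝ) - 3)⁻¹ * b ≤ codeLength P b := Nat.le_ceil _
  rw [inv_mul_le_iff₀ hR] at h
  have : (b : ℝ) + 3 * codeLength P b ≤ 2 * bitsPerDim P * codeLength P b := by linarith
  exact_mod_cast this

theorem tendsto_codeLength_div {P : ℝ} (hP : 2 ≤ bitsPerDim P) :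
    Tendsto (fun b : ℕ => (codeLength P b : ℝ) / b) atTop
      (𝓝 (2 * (bitsPerDim P : ℝ) - 3)⁻¹) := by
  have hR : (0 : ℝ) < 2 * bitsPerDim P - 3 := by
    have : (2 : ℝ) ≤ bitsPerDim P := by exact_mod_cast hP
    linarith
  exact (tendsto_nat_ceil_mul_div_atTop (inv_nonneg.mpr hR.le)).comp tendsto_natCast_atTop_atTop

theorem tendsto_codeLength_atTop {P : ℝ} (hP : 2 ≤ bitsPerDim P) :
    Tendsto (codeLength P) atTop atTop := by
  have hR : (0 : ℝ) < 2 * bitsPerDim P - 3 := by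
    have : (2 : ℝ) ≤ bitsPerDim P := by exact_mod_cast hP
    linarith
  exact tendsto_nat_ceil_atTop.comp
    (tendsto_natCast_atTop_atTop.const_mul_atTop (inv_pos.mpr hR))

end Rate

/-! ### Minimum-distance decoding -/

section Decoder

/-- If `y` lies within squared distance `t` of the word of `w₀` and any two words are at squared
distance at least `4 t`, then `w₀` is the only message whose word is so close. -/
theorem eq_of_dist_lt {n : ℕ} {W : Type*} {c : W → Fin n → ℂ} {t : ℝ}
    (hsep : ∀ w w', w ≠ w' → 4 * t ≤ ∑ τ, ‖c w τ - c w' τ‖ ^ 2) {y : Fin n → ℂ} {w w' : W}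
    (h : ∑ τ, ‖y τ - c w τ‖ ^ 2 < t) (h' : ∑ τ, ‖y τ - c w' τ‖ ^ 2 < t) : w = w' := by
  by_contra hne
  have h1 : ∑ τ, ‖c w τ - c w' τ‖ ^ 2 ≤
      ∑ τ, (2 * ‖y τ - c w τ‖ ^ 2 + 2 * ‖y τ - c w' τ‖ ^ 2) := by
    refine Finset.sum_le_sum fun τ _ => ?_
    have h2 : ‖c w τ - c w' τ‖ ≤ ‖y τ - c w τ‖ + ‖y τ - c w' τ‖ := by
      calc ‖c w τ - c w' τ‖ = ‖(y τ - c w' τ) - (y τ - c w τ)‖ := by congr 1; ring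
        _ ≤ _ := by rw [add_comm]; exact norm_sub_le _ _
    have h3 := pow_le_pow_left₀ (norm_nonneg _) h2 2
    nlinarith [sq_nonneg (‖y τ - c w τ‖ - ‖y τ - c w' τ‖)]
  rw [Finset.sum_add_distrib, ← Finset.mul_sum, ← Finset.mul_sum] at h1
  have := hsep w w' hne
  linarith

open Classical in
/-- The message whose word lies within squared distance `t` of `y`, read bit by bit. -/
noncomputable def nearWord {b n : ℕ} (c : (Fin b → Bool) → Fin n → ℂ) (t : ℝ) (y : Fin n → ℂ) :
    Fin b → Bool :=
  fun i => decide (∃ w, w i = true ∧ ∑ τ, ‖y τ - c w τ‖ ^ 2 < t)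

theorem nearWord_eq {b n : ℕ} {c : (Fin b → Bool) → Fin n → ℂ} {t : ℝ}
    (hsep : ∀ w w', w ≠ w' → 4 * t ≤ ∑ τ, ‖c w τ - c w' τ‖ ^ 2) {y : Fin n → ℂ}
    {w₀ : Fin b → Bool} (h : ∑ τ, ‖y τ - c w₀ τ‖ ^ 2 < t) : nearWord c t y = w₀ := by
  funext i
  rw [nearWord, Bool.eq_iff_iff, decide_eq_true_iff]
  constructor
  · rintro ⟨w, hw, hwt⟩
    rwa [← eq_of_dist_lt hsep hwt h]
  · exact fun hi => ⟨w₀, hi, h⟩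

/-- Each bit equals one exactly on a finite union of open balls, one for each word with that bit. -/
theorem measurable_nearWord {b n : ℕ} (c : (Fin b → Bool) → Fin n → ℂ) (t : ℝ) :
    Measurable (nearWord c t) := by
  refine measurable_pi_lambda _ fun i => measurable_to_bool ?_
  have : (fun y => nearWord c t y i) ⁻¹' {true} =
      ⋃ w ∈ {w : Fin b → Bool | w i = true}, {y : Fin n → ℂ | ∑ τ, ‖y τ - c w τ‖ ^ 2 < t} := by
    ext y
    simp [nearWord]
  rw [this]
  refine MeasurableSet.biUnion (Set.to_countable _) fun w _ => measurableSet_lt ?_ ?_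
  · fun_prop
  · exact measurable_const

end Decoder

/-! ### The zero-forcing scheme of a delivery array -/

namespace ZeroForcing

variable {K L S F : ℕ}

/-- The code that carries `b` bits at transmit power `P`. -/
noncomputable def code (P : ℝ) (b : ℕ) : (Fin b → Bool) → Fin (codeLength P b) → ℂ :=
  Classical.choose (exists_complex_code (bitsPerDim P) b (codeLength P b))

theorem norm_code_le (P : ℝ) (b : ℕ) (w : Fin b → Bool) (τ : Fin (codeLength P b)) :
    ‖code P b w τ‖ ≤ 1 :=
  (Classical.choose_spec (exists_complex_code (bitsPerDim P) b (codeLength P b))).1 w τ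

theorem code_separated {P : ℝ} (hP : 2 ≤ bitsPerDim P) (b : ℕ) {w w' : Fin b → Bool}
    (h : w ≠ w') : (codeLength P b : ℝ) ≤
      bitsPerDim P * 4 ^ (bitsPerDim P + 1) * ∑ τ, ‖code P b w τ - code P b w' τ‖ ^ 2 :=
  (Classical.choose_spec (exists_complex_code (bitsPerDim P) b (codeLength P b))).2 (by omega)
    (add_codeLength_le hP b) w w' h

/-- A constant such that the noise energy per channel use exceeds it with small probability. -/
noncomputable def noiseLevel : ℝ := Classical.choose exists_noise_energy_bound

theorem noiseLevel_pos : 0 < noiseLevel := (Classical.choose_spec exists_noise_energy_bound).1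

theorem noise_energy_bound (n : ℕ) :
    (Measure.pi fun _ : Fin n => complexGaussian).real {z | noiseLevel * n ≤ ∑ τ, ‖z τ‖ ^ 2} ≤
      (1 / 2) ^ n :=
  (Classical.choose_spec exists_noise_energy_bound).2 n

variable (D : Fin F → Fin K → Option (Fin S))

/-- The users served by the transmission `s`: those whose column contains `s`. -/
def Served (s : Fin S) (u : Fin K) : Prop := ∃ j, D j u = some s

open Classical in
/-- The row of the integer `s` in the column `u`. -/
noncomputable def rowOf (hF : 0 < F) (s : Fin S) (u : Fin K) : Fin F :=
  if h : Served D s u then h.choose else ⟨0, hF⟩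

theorem apply_rowOf {D : Fin F → Fin K → Option (Fin S)} (hF : 0 < F) {s : Fin S} {u : Fin K}
    (h : Served D s u) : D (rowOf D hF s u) u = some s := by
  rw [rowOf, dif_pos h]
  exact h.choose_spec

open Classical in
/-- The served users at which the signal for the user `u` cannot be cancelled with the help of
the caches. -/
noncomputable def hearers (hF : 0 < F) (s : Fin S) (u : Fin K) : Finset (Fin K) :=
  Finset.univ.filter fun k => Served D s k ∧ D (rowOf D hF s u) k ≠ none

/-- The beamforming vector for the user `u` in the transmission `s`. -/
noncomputable def beam (hF : 0 < F) (hK : 0 < K) (hL : 0 < L) (s : Fin S) (h : Channel K L)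
    (u : Fin K) : Fin L → ℂ :=
  Classical.choose (exists_zeroForcing h (ε := 1 / ((K : ℝ) * L)) (by positivity)
    (hearers D hF s u) u)

variable (hF : 0 < F) (hK : 0 < K) (hL : 0 < L)

/-- The gain at the user `k` of the signal for the user `u`. -/
noncomputable def gain (s : Fin S) (h : Channel K L) (k u : Fin K) : ℂ :=
  ∑ a, h k a * beam D hF hK hL s h u a

theorem norm_beam_le (s : Fin S) (h : Channel K L) (u : Fin K) (a : Fin L) :
    ‖beam D hF hK hL s h u a‖ ≤ 1 / (K * L) :=
  (Classical.choose_spec (exists_zeroForcing h (ε := 1 / ((K : ℝ) * L)) (by positivity)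
    (hearers D hF s u) u)).1 a

section

variable {D} {C : Fin F → Fin K → Bool} {r : ℕ}

/-- The row condition of the delivery array serves precisely to make zero-forcing with `L` antennas
possible. -/
theorem card_hearers_le (hD : IsDeliveryArray C r S L D) {s : Fin S} {u : Fin K} (hu : Served D s u) :
    (hearers D hF s u).card ≤ L := by
  refine le_trans (le_of_eq ?_) (hD.row s (rowOf D hF s u) ⟨u, apply_rowOf hF hu⟩)
  rw [hearers]
  congr

theorem mem_hearers {s : Fin S} {u k : Fin K} (hk : Served D s k)
    (hrow : D (rowOf D hF s u) k ≠ none) : k ∈ hearers D hF s u := by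
  classical
  rw [hearers, Finset.mem_filter]
  exact ⟨Finset.mem_univ _, hk, hrow⟩

theorem mem_hearers_self {s : Fin S} {u : Fin K} (hu : Served D s u) : u ∈ hearers D hF s u :=
  mem_hearers hF hu (by simp [apply_rowOf hF hu])

theorem gain_self_ne_zero (hD : IsDeliveryArray C r S L D) {h : Channel K L} (hg : h.Generic) {s : Fin S} {u : Fin K}
    (hu : Served D s u) : gain D hF hK hL s h u u ≠ 0 :=
  ((Classical.choose_spec (exists_zeroForcing h (ε := 1 / ((K : ℝ) * L)) (by positivity)
    (hearers D hF s u) u)).2 hg (card_hearers_le hF hD hu) (mem_hearers_self hF hu)).1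

theorem gain_eq_zero (hD : IsDeliveryArray C r S L D) {h : Channel K L}
    (hg : h.Generic) {s : Fin S} {u k : Fin K}
    (hu : Served D s u) (hk : Served D s k) (hne : k ≠ u) (hrow : D (rowOf D hF s u) k ≠ none) :
    gain D hF hK hL s h k u = 0 :=
  ((Classical.choose_spec (exists_zeroForcing h (ε := 1 / ((K : ℝ) * L)) (by positivity)
    (hearers D hF s u) u)).2 hg (card_hearers_le hF hD hu) (mem_hearers_self hF hu)).2 k
      (mem_hearers hF hk hrow) hne

end

open Classical in
/-- The signal for the user `u` in the transmission `s`, when the user is served. -/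
noncomputable def signal {N : ℕ} (P : ℝ) (b : ℕ) (d : Fin K → Fin N) (s : Fin S)
    (h : Channel K L) (W : Library N F b) (u : Fin K) (τ : Fin (codeLength P b)) (a : Fin L) : ℂ :=
  if Served D s u then
    √P * beam D hF hK hL s h u a * code P b (W (d u) (rowOf D hF s u)) τ
  else 0

open Classical in
/-- The part of the received signal that the user `k` computes from the caches. -/
noncomputable def knownInterference {N : ℕ} (P : ℝ) (b : ℕ) (d : Fin K → Fin N) (s : Fin S)
    (h : Channel K L) (k : Fin K) (I : SideInfo N F b) (τ : Fin (codeLength P b)) : ℂ :=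
  ∑ u, if Served D s u ∧ D (rowOf D hF s u) k = none then
    √P * gain D hF hK hL s h k u *
      code P b ((I (d u) (rowOf D hF s u)).getD fun _ => false) τ
  else 0

/-- The estimate of a subfile from the signal received in the transmission `s`. -/
noncomputable def estimate {N : ℕ} (P : ℝ) (b : ℕ) (d : Fin K → Fin N) (s : Fin S)
    (h : Channel K L) (k : Fin K) (I : SideInfo N F b) (y : Fin (codeLength P b) → ℂ) :
    Fin b → Bool :=
  nearWord (fun w τ => √P * gain D hF hK hL s h k k * code P b w τ)
    (noiseLevel * codeLength P b)
    (fun τ => y τ - knownInterference D hF hK hL P b d s h k I τ)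

/-- The scheme of a delivery array: in the transmission `s`, every user whose column contains `s`
is sent the subfile of the row of `s`, along a beam that is not heard by the served users who do
not have this subfile. -/
noncomputable abbrev scheme (N : ℕ) (C : Fin F → Fin K → Bool) : MACCScheme K L N F where
  cached := placementOf N C
  numTx := S
  len P b _ _ _ := codeLength P b
  encode P b d s h W τ a := ∑ u, signal D hF hK hL P b d s h W u τ a
  decode P b d H k I y j := match I (d k) j, D j k with
    | some w, _ => w
    | none, some s => estimate D hF hK hL P b d s (H s) k I (y s)
    | none, none => fun _ => false
  measurable_decode P b d H k I := by
    refine measurable_pi_lambda _ fun j => ?_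
    cases I (d k) j with
    | some w => exact measurable_const
    | none =>
      cases D j k with
      | none => exact measurable_const
      | some s =>
        refine (measurable_nearWord _ _).comp (measurable_pi_lambda _ fun τ => ?_)
        exact ((measurable_pi_apply τ).comp (measurable_pi_apply s)).sub_const _

theorem norm_signal_le {N : ℕ} (P : ℝ) (b : ℕ) (d : Fin K → Fin N) (s : Fin S)
    (h : Channel K L) (W : Library N F b) (u : Fin K) (τ : Fin (codeLength P b)) (a : Fin L) :
    ‖signal D hF hK hL P b d s h W u τ a‖ ≤ √P / (K * L) := by
  rw [signal]
  split_ifs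
  · rw [norm_mul, norm_mul, Complex.norm_real, Real.norm_of_nonneg (Real.sqrt_nonneg P)]
    calc _ ≤ √P * (1 / (K * L)) * 1 := by
          gcongr
          · exact norm_beam_le D hF hK hL s h u a
          · exact norm_code_le P b _ τ
      _ = _ := by ring
  · rw [norm_zero]
    positivity

/-- The bound `1 / (K * L)` on the beams gives amplitude at most `√P / L` per antenna after summing
over the users. The power constraint then holds for every library, not only on average. -/
theorem scheme_respectsPower (N : ℕ) (C : Fin F → Fin K → Bool) :
    (scheme D hF hK hL N C).RespectsPower := by
  intro P b d s h τ hP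
  have hcard : (0 : ℝ) < Fintype.card (Library N F b) := by exact_mod_cast Fintype.card_pos
  have hK' : (0 : ℝ) < K := by exact_mod_cast hK
  have hL' : (1 : ℝ) ≤ L := by exact_mod_cast hL
  rw [div_le_iff₀ hcard]
  have hx : ∀ W a, ‖(scheme D hF hK hL N C).encode P b d s h W τ a‖ ≤ √P / L := by
    intro W a
    calc _ ≤ ∑ u, ‖signal D hF hK hL P b d s h W u τ a‖ := norm_sum_le _ _
      _ ≤ ∑ _u : Fin K, √P / (K * L) :=
          Finset.sum_le_sum fun u _ => norm_signal_le D hF hK hL P b d s h W u τ a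
      _ = √P / L := by
          rw [Finset.sum_const, Finset.card_univ, Fintype.card_fin, nsmul_eq_mul]
          field_simp
  calc _ ≤ ∑ _W : Library N F b, P := by
        refine Finset.sum_le_sum fun W _ => ?_
        calc _ ≤ ∑ _a : Fin L, (√P / L) ^ 2 :=
              Finset.sum_le_sum fun a _ => pow_le_pow_left₀ (norm_nonneg _) (hx W a) 2
          _ = P / L := by
              rw [Finset.sum_const, Finset.card_univ, Fintype.card_fin, nsmul_eq_mul, div_pow,
                Real.sq_sqrt hP.le]
              field_simp
          _ ≤ P := div_le_self hP.le hL'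
    _ = _ := by
        rw [Finset.sum_const, Finset.card_univ, nsmul_eq_mul, mul_comm]

section Decoding

variable {D} {C : Fin F → Fin K → Bool} {r N : ℕ}

theorem sideInfo_of_eq_none (hD : IsDeliveryArray C r S L D) 
    {b : ℕ} (W : Library N F b) {j : Fin F} {k : Fin K}
    (h : D j k = none) (n : Fin N) :
    (scheme D hF hK hL N C).sideInfo r W k n j = some (W n j) := by
  obtain ⟨i, hi, hC⟩ := (hD.star j k).mp h
  rw [MACCScheme.sideInfo, if_pos]
  exact ⟨i, Finset.mem_range.mpr hi, Finset.mem_filter.mpr ⟨Finset.mem_univ _, hC⟩⟩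

theorem sideInfo_of_ne_none (hD : IsDeliveryArray C r S L D) 
    {b : ℕ} (W : Library N F b) {j : Fin F} {k : Fin K}
    (h : D j k ≠ none) (n : Fin N) :
    (scheme D hF hK hL N C).sideInfo r W k n j = none := by
  rw [MACCScheme.sideInfo, if_neg]
  rintro ⟨i, hi, hC⟩
  exact h ((hD.star j k).mpr ⟨i, Finset.mem_range.mp hi, (Finset.mem_filter.mp hC).2⟩)

/-- A signal meant for `u ≠ k` is either for a subfile that `k` has, hence computable from the
caches, or for one that `k` lacks, and then its beam is silent at `k`. -/
theorem sum_encode_eq (hD : IsDeliveryArray C r S L D) 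
    (P : ℝ) (b : ℕ) (d : Fin K → Fin N) {s : Fin S} {h : Channel K L}
    (hg : h.Generic) (W : Library N F b) {j : Fin F} {k : Fin K} (hjk : D j k = some s)
    (τ : Fin (codeLength P b)) :
    ∑ a, h k a * (scheme D hF hK hL N C).encode P b d s h W τ a =
      √P * gain D hF hK hL s h k k * code P b (W (d k) j) τ +
        knownInterference D hF hK hL P b d s h k ((scheme D hF hK hL N C).sideInfo r W k) τ := by
  classical
  have hk : Served D s k := ⟨j, hjk⟩
  have hrow : rowOf D hF s k = j := hD.column k s _ _ (apply_rowOf hF hk) hjk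
  have hterm : ∀ u, ∑ a, h k a * signal D hF hK hL P b d s h W u τ a =
      if Served D s u then
        √P * gain D hF hK hL s h k u * code P b (W (d u) (rowOf D hF s u)) τ else 0 := by
    intro u
    by_cases hu : Served D s u
    · simp only [signal, if_pos hu, gain, Finset.mul_sum, Finset.sum_mul]
      exact Finset.sum_congr rfl fun a _ => by ring
    · simp [signal, if_neg hu]
  calc ∑ a, h k a * (scheme D hF hK hL N C).encode P b d s h W τ a
      = ∑ a, ∑ u, h k a * signal D hF hK hL P b d s h W u τ a :=
        Finset.sum_congr rfl fun a _ => Finset.mul_sum _ _ _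
    _ = ∑ u, if Served D s u then
        √P * gain D hF hK hL s h k u * code P b (W (d u) (rowOf D hF s u)) τ else 0 := by
        rw [Finset.sum_comm]
        exact Finset.sum_congr rfl fun u _ => hterm u
    _ = ∑ u, ((if u = k then √P * gain D hF hK hL s h k k * code P b (W (d k) j) τ else 0) +
          if Served D s u ∧ D (rowOf D hF s u) k = none then
            √P * gain D hF hK hL s h k u * code P b
              (((scheme D hF hK hL N C).sideInfo r W k (d u) (rowOf D hF s u)).getD
                fun _ => false) τ
          else 0) := by
        refine Finset.sum_congr rfl fun u _ => ?_
        by_cases huk : u = k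
        · subst huk
          -- The row `j` is not a star in column `k`, so the desired signal is not counted as known
          -- interference.
          simp [hk, hrow, hjk]
        by_cases hu : Served D s u
        · by_cases hn : D (rowOf D hF s u) k = none
          · rw [sideInfo_of_eq_none hF hK hL hD W hn]
            simp [huk, hu, hn]
          · simp [huk, hu, hn, gain_eq_zero hF hK hL hD hg hu hk (Ne.symm huk) hn]
        · simp [huk, hu]
    _ = _ := by
        rw [Finset.sum_add_distrib, Finset.sum_ite_eq' Finset.univ k]
        simp only [Finset.mem_univ, if_true]
        rfl

theorem decode_of_eq_some {P : ℝ} {b : ℕ} {d : Fin K → Fin N} {H : Fin S → Channel K L}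
    {k : Fin K} {I : SideInfo N F b} {j : Fin F} {w : Fin b → Bool} (h : I (d k) j = some w)
    (y : Fin S → Fin (codeLength P b) → ℂ) :
    (scheme D hF hK hL N C).decode P b d H k I y j = w := by
  simp [h]

theorem decode_of_eq_none {P : ℝ} {b : ℕ} {d : Fin K → Fin N} {H : Fin S → Channel K L}
    {k : Fin K} {I : SideInfo N F b} {j : Fin F} {s : Fin S} (h : I (d k) j = none)
    (hs : D j k = some s) (y : Fin S → Fin (codeLength P b) → ℂ) :
    (scheme D hF hK hL N C).decode P b d H k I y j =
      estimate D hF hK hL P b d s (H s) k I (y s) := by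
  simp [h, hs]

/-- The gains at the served users are large enough, compared to the noise, for the spacing of the
code. -/
def StrongGains (D : Fin F → Fin K → Option (Fin S)) (H : Fin S → Channel K L) (P : ℝ) : Prop :=
  ∀ s u, Served D s u → 4 * noiseLevel * (bitsPerDim P * 4 ^ (bitsPerDim P + 1)) ≤
    P * ‖gain D hF hK hL s (H s) u u‖ ^ 2

/-- The user `k` decodes correctly if the gains are large enough and the noise is not too
strong. -/
theorem decode_eq (hD : IsDeliveryArray C r S L D) {P : ℝ} {b : ℕ} (d : Fin K → Fin N)
    {H : Fin S → Channel K L} (hg : ∀ s, (H s).Generic) (hP0 : 0 < P) (hP : 2 ≤ bitsPerDim P)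
    (hPg : StrongGains hF hK hL D H P)
    (W : Library N F b) (k : Fin K) (z : Fin S → Fin (codeLength P b) → ℂ)
    (hz : ∀ s, ∑ τ, ‖z s τ‖ ^ 2 < noiseLevel * codeLength P b) :
    (scheme D hF hK hL N C).decode P b d H k ((scheme D hF hK hL N C).sideInfo r W k)
      ((scheme D hF hK hL N C).received P b d H W k z) = W (d k) := by
  funext j
  cases hjk : D j k with
  | none => exact decode_of_eq_some hF hK hL (sideInfo_of_eq_none hF hK hL hD W hjk (d k)) _
  | some s =>
    refine (decode_of_eq_none hF hK hL
      (sideInfo_of_ne_none hF hK hL hD W (j := j) (by simp [hjk]) (d k)) hjk _).trans ?_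
    refine nearWord_eq (fun w w' hw => ?_) ?_
    · have hsep := code_separated hP b hw
      have hgain := hPg s k ⟨j, hjk⟩
      set X := ∑ τ, ‖code P b w τ - code P b w' τ‖ ^ 2 with hX
      set Y : ℝ := bitsPerDim P * 4 ^ (bitsPerDim P + 1) with hY
      have hX0 : 0 ≤ X := Finset.sum_nonneg fun τ _ => by positivity
      have hsum : ∑ τ, ‖√P * gain D hF hK hL s (H s) k k * code P b w τ -
          √P * gain D hF hK hL s (H s) k k * code P b w' τ‖ ^ 2 =
          P * ‖gain D hF hK hL s (H s) k k‖ ^ 2 * X := by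
        rw [hX, Finset.mul_sum]
        refine Finset.sum_congr rfl fun τ _ => ?_
        rw [← mul_sub, norm_mul, norm_mul, mul_pow, mul_pow, Complex.norm_real,
          Real.norm_of_nonneg (Real.sqrt_nonneg P), Real.sq_sqrt hP0.le]
      have hN := noiseLevel_pos
      -- The received words are four noise thresholds apart in squared distance, as `nearWord_eq`
      -- needs.
      calc 4 * (noiseLevel * codeLength P b) ≤ 4 * (noiseLevel * (Y * X)) := by gcongr
        _ = 4 * noiseLevel * Y * X := by ring
        _ ≤ P * ‖gain D hF hK hL s (H s) k k‖ ^ 2 * X := by gcongr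
        _ = _ := hsum.symm
    -- After subtraction of the known interference, only noise separates the received signal from
    -- the true word.
    · refine lt_of_eq_of_lt (Finset.sum_congr rfl fun τ _ => ?_) (hz s)
      have h := sum_encode_eq hF hK hL (N := N) hD P b d (hg s) W hjk τ
      have hrec : (scheme D hF hK hL N C).received P b d H W k z s τ =
          (∑ a, H s k a * (scheme D hF hK hL N C).encode P b d s (H s) W τ a) + z s τ := rfl
      rw [hrec, h]
      congr 2
      ring

/-- For each fixed library, an error forces excessive noise in some transmission; a union bound over
the `S` transmissions follows. -/
theorem errorProb_le (hD : IsDeliveryArray C r S L D) {P : ℝ} {b : ℕ} (d : Fin K → Fin N)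
    {H : Fin S → Channel K L} (hg : ∀ s, (H s).Generic) (hP0 : 0 < P) (hP : 2 ≤ bitsPerDim P)
    (hPg : StrongGains hF hK hL D H P) (k : Fin K) :
    (scheme D hF hK hL N C).errorProb r P b H d k ≤ S * (1 / 2) ^ codeLength P b := by
  have hcard : (0 : ℝ) < Fintype.card (Library N F b) := by exact_mod_cast Fintype.card_pos
  refine (div_le_iff₀ hcard).mpr ?_
  let ν : Measure (Fin (codeLength P b) → ℂ) := Measure.pi fun _ => complexGaussian
  let bad : Set (Fin (codeLength P b) → ℂ) :=
    {z | noiseLevel * codeLength P b ≤ ∑ τ, ‖z τ‖ ^ 2}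
  have hbad : MeasurableSet bad := measurableSet_le measurable_const (by fun_prop)
  have hW : ∀ W : Library N F b, ((scheme D hF hK hL N C).noise P b d H).real
      {z | (scheme D hF hK hL N C).decode P b d H k ((scheme D hF hK hL N C).sideInfo r W k)
        ((scheme D hF hK hL N C).received P b d H W k z) ≠ W (d k)} ≤
      S * (1 / 2) ^ codeLength P b := by
    intro W
    change (Measure.pi fun _ : Fin S => ν).real _ ≤ _
    calc _ ≤ (Measure.pi fun _ : Fin S => ν).real (⋃ s : Fin S, (fun z => z s) ⁻¹' bad) := by
          refine measureReal_mono fun z hz => ?_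
          by_contra hnot
          refine hz (decode_eq hF hK hL hD d hg hP0 hP hPg W k z fun s => ?_)
          rw [Set.mem_iUnion, not_exists] at hnot
          exact not_le.mp (hnot s)
      _ ≤ ∑ s : Fin S, (Measure.pi fun _ : Fin S => ν).real ((fun z => z s) ⁻¹' bad) :=
          measureReal_iUnion_fintype_le _
      _ ≤ ∑ _s : Fin S, (1 / 2 : ℝ) ^ codeLength P b := by
          refine Finset.sum_le_sum fun s _ => ?_
          have h := (measurePreserving_eval (fun _ : Fin S => ν) s).measureReal_preimage
            hbad.nullMeasurableSet
          exact h.trans_le (noise_energy_bound _)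
      _ = _ := by simp
  calc _ ≤ ∑ _W : Library N F b, (S : ℝ) * (1 / 2) ^ codeLength P b :=
        Finset.sum_le_sum fun W _ => hW W
    _ = _ := by rw [Finset.sum_const, Finset.card_univ, nsmul_eq_mul, mul_comm]

theorem worstErrorProb_nonneg (σ : MACCScheme K L N F) (r : ℕ) (P : ℝ) (b : ℕ)
    (H : Fin σ.numTx → Channel K L) : 0 ≤ σ.worstErrorProb r P b H :=
  Real.iSup_nonneg fun _ => div_nonneg (Finset.sum_nonneg fun _ _ => measureReal_nonneg)
    (Nat.cast_nonneg _)

theorem worstErrorProb_le (hD : IsDeliveryArray C r S L D) {P : ℝ} {b : ℕ}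
    {H : Fin S → Channel K L} (hg : ∀ s, (H s).Generic) (hP0 : 0 < P) (hP : 2 ≤ bitsPerDim P)
    (hPg : StrongGains hF hK hL D H P) :
    (scheme D hF hK hL N C).worstErrorProb r P b H ≤ S * (1 / 2) ^ codeLength P b :=
  Real.iSup_le (fun x => errorProb_le hF hK hL hD x.1 hg hP0 hP hPg x.2) (by positivity)

/-- The beams do not depend on `P`, so the finitely many gains are fixed nonzero numbers, while `ℓ 4
^ ℓ / P` tends to `0`. -/
theorem eventually_strongGains (hD : IsDeliveryArray C r S L D) {H : Fin S → Channel K L}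
    (hg : ∀ s, (H s).Generic) : ∀ᶠ P in atTop, StrongGains hF hK hL D H P := by
  simp only [StrongGains, eventually_all]
  intro s u hu
  have hgain : 0 < ‖gain D hF hK hL s (H s) u u‖ ^ 2 :=
    pow_pos (norm_pos_iff.mpr (gain_self_ne_zero hF hK hL hD (hg s) hu)) 2
  have h := tendsto_bitsPerDim_mul_pow_div.const_mul (16 * noiseLevel)
  rw [mul_zero] at h
  filter_upwards [h.eventually_lt_const hgain, eventually_gt_atTop 0] with P hP hP0
  rw [← mul_div_assoc, div_lt_iff₀ hP0] at hP
  rw [pow_succ]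
  linarith

theorem tendsto_worstErrorProb (hD : IsDeliveryArray C r S L D) {P : ℝ}
    {H : Fin S → Channel K L} (hg : ∀ s, (H s).Generic) (hP0 : 0 < P) (hP : 2 ≤ bitsPerDim P)
    (hPg : StrongGains hF hK hL D H P) :
    Tendsto (fun b => (scheme D hF hK hL N C).worstErrorProb r P b H) atTop (𝓝 0) := by
  have hlim : Tendsto (fun b => (S : ℝ) * (1 / 2) ^ codeLength P b) atTop (𝓝 0) := by
    have h := ((tendsto_pow_atTop_nhds_zero_of_lt_one (r := (1 / 2 : ℝ)) (by norm_num)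
      (by norm_num)).comp (tendsto_codeLength_atTop hP)).const_mul (S : ℝ)
    rwa [mul_zero] at h
  exact squeeze_zero (fun b => worstErrorProb_nonneg (scheme D hF hK hL N C) r P b H)
    (fun b => worstErrorProb_le hF hK hL hD hg hP0 hP hPg) hlim

theorem scheme_isAchievable (hD : IsDeliveryArray C r S L D) {H : Fin S → Channel K L}
    (hg : ∀ s, (H s).Generic) : (scheme D hF hK hL N C).IsAchievable r H :=
  ((eventually_strongGains hF hK hL hD hg).and ((eventually_gt_atTop 0).and
    eventually_le_bitsPerDim)).mono fun _ h =>
      tendsto_worstErrorProb hF hK hL hD hg h.2.1 h.2.2 h.1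

theorem deliveryTime_scheme [Nonempty (Fin N)] (P : ℝ) (b : ℕ) (H : Fin S → Channel K L) :
    (scheme D hF hK hL N C).deliveryTime P b H = S * codeLength P b := by
  have h : ∀ d : Fin K → Fin N,
      ∑ s, (scheme D hF hK hL N C).len P b d s (H s) = S * codeLength P b := by
    intro d
    change ∑ _s : Fin S, codeLength P b = _
    simp
  exact (Finset.sup_congr rfl fun d _ => h d).trans (Finset.sup_const Finset.univ_nonempty _)

theorem scheme_hasNormalizedDeliveryTime [Nonempty (Fin N)] (H : Fin S → Channel K L) :
    (scheme D hF hK hL N C).HasNormalizedDeliveryTime H ((S : ℝ) / F) := by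
  -- At fixed power, the code length is asymptotically `b / (2 ℓ - 3)` and the files have `F * b`
  -- bits.
  refine ⟨fun P => (S : ℝ) / F * (Real.logb 2 P / (2 * bitsPerDim P - 3)), ?_, ?_⟩
  · filter_upwards [eventually_le_bitsPerDim] with P hP
    have h := (tendsto_codeLength_div hP).const_mul ((S : ℝ) / F * Real.logb 2 P)
    rw [mul_assoc, ← div_eq_mul_inv] at h
    refine h.congr fun b => ?_
    rw [deliveryTime_scheme]
    push_cast
    rw [div_div_eq_mul_div, div_mul_eq_mul_div, div_mul_div_comm]
    congr 1
    ring
  · have h := tendsto_logb_div_rate.const_mul ((S : ℝ) / F)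
    rwa [mul_one] at h

end Decoding

end ZeroForcing

/-! ### Memory and the final theorem -/

theorem card_placementOf {K F Z r : ℕ} {C : Fin F → Fin K → Bool} (hC : IsCachingArray K F Z r C)
    (N : ℕ) (i : Fin K) : (placementOf N C i).card = N * Z := by
  have h : placementOf N C i =
      Finset.univ ×ˢ (Finset.univ.filter fun j => C j i = true) := by
    ext p
    simp [placementOf]
  rw [h, Finset.card_product, hC.card_star, Finset.card_univ, Fintype.card_fin]

/-- Every delivery array of a caching array gives a scheme with normalized delivery time
`S / F`. -/
theorem IsDeliveryArray.exists_scheme {K F Z r S L : ℕ} {C : Fin F → Fin K → Bool}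
    {D : Fin F → Fin K → Option (Fin S)} (hD : IsDeliveryArray C r S L D)
    (hC : IsCachingArray K F Z r C) {N : ℕ} (hN : 0 < N) {M : ℝ} (hM : (N : ℝ) * Z / F ≤ M) :
    ∃ σ : MACCScheme K L N F, σ.cached = placementOf N C ∧ σ.numTx = S ∧ σ.RespectsMemory M ∧
      σ.RespectsPower ∧ ∀ H : Fin σ.numTx → Channel K L, (∀ s, (H s).Generic) →
        σ.IsAchievable r H ∧ σ.HasNormalizedDeliveryTime H ((S : ℝ) / F) := by
  have : Nonempty (Fin N) := ⟨⟨0, hN⟩⟩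
  refine ⟨ZeroForcing.scheme D hC.F_pos hC.K_pos hD.L_pos N C, rfl, rfl, fun i => ?_,
    ZeroForcing.scheme_respectsPower D _ _ _ N C, fun H hg =>
      ⟨ZeroForcing.scheme_isAchievable _ _ _ hD hg,
        ZeroForcing.scheme_hasNormalizedDeliveryTime _ _ _ H⟩⟩
  change ((placementOf N C i).card : ℝ) / F ≤ M
  rw [card_placementOf hC]
  exact_mod_cast hM

theorem lemma2 (r K' L' F' Z' S' : ℕ) (hr : 0 < r) (A : Fin F' → Fin K' → Option (Fin S'))
    (hA : IsEPDA K' L' F' Z' S' A) :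
    IsCachingArray (r * K') (r * F') Z' r (cachingArrayOf r A) ∧
    IsDeliveryArray (cachingArrayOf r A) r (r * S') (r * L') (deliveryArrayOf r A) ∧
    ∀ (N : ℕ) (M : ℝ), 0 < N →
      ((r * K' : ℕ) : ℝ) * M / (N : ℝ) = (K' : ℝ) * (Z' : ℝ) / (F' : ℝ) →
      ∃ σ : MACCScheme (r * K') (r * L') N (r * F'),
        σ.cached = placementOf N (cachingArrayOf r A) ∧
        σ.numTx = r * S' ∧
        σ.RespectsMemory M ∧
        σ.RespectsPower ∧
        ∀ H : Fin σ.numTx → Channel (r * K') (r * L'), (∀ s, (H s).Generic) →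
          σ.IsAchievable r H ∧
          σ.HasNormalizedDeliveryTime H ((S' : ℝ) / (F' : ℝ)) := by
  have hC := hA.isCachingArray hr
  have hD := hA.isDeliveryArray hr
  refine ⟨hC, hD, fun N M hN hM => ?_⟩
  have hr' : (r : ℝ) ≠ 0 := by exact_mod_cast hr.ne'
  have hK : (K' : ℝ) ≠ 0 := by exact_mod_cast hA.K_pos.ne'
  have hF : (F' : ℝ) ≠ 0 := by exact_mod_cast hA.F_pos.ne'
  have hN' : (N : ℝ) ≠ 0 := by exact_mod_cast hN.ne'
  -- The prescribed value of `t` makes the caches exactly full.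
  have hMem : (N : ℝ) * Z' / ((r * F' : ℕ) : ℝ) ≤ M := by
    refine le_of_eq ?_
    push_cast at hM ⊢
    rw [div_eq_div_iff hN' hF] at hM
    rw [div_eq_iff (mul_ne_zero hr' hF)]
    refine mul_left_cancel₀ hK ?_
    linear_combination -hM
  have hT : ((r * S' : ℕ) : ℝ) / ((r * F' : ℕ) : ℝ) = (S' : ℝ) / F' := by
    push_cast
    exact mul_div_mul_left _ _ hr'
  have h := hD.exists_scheme hC hN hMem
  rwa [hT] at h
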